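/- **Notation.** Let $d\in\mathbb N$ and let $\Omega\subset\mathbb R^d$ be open. Distributions and test functions take values in $\mathbb K=\mathbb R$ or $\mathbb K=\mathbb C$. $\mathscr D(\Omega)$ is the space of test functions on $\Omega$ with its usual (LF) topology, and $\mathscr D'(\Omega)$ is its dual with the strong topology. For $x,y\in\mathbb R^d$ put $xy=(x_1y_1,\dots,x_dy_d)$, let $\mathbb R_*^d=(\mathbb R\setminus\{0\})^d$, and for $M\subset\mathbb R_*^d$ let $1/M=\{(1/y_1,\dots,1/y_d): y\in M\}$. Let $\tilde\Omega=\bigcup_{a\in\mathbb R_*^d}a\Omega$; this is an open set that contains $\Omega$ and is invariant under the dilations $x\mapsto xy$, $y\in\mathbb R_*^d$. A *Hadamard operator* on $\mathscr D'(\Omega)$ is a continuous linear map $L:\mathscr D'(\Omega)\to\mathscr D'(\Omega)$ which admits all monomials as eigenvectors, i.e. for every $\alpha\in\mathbb N_0^d$ there is $m_\alpha\in\mathbb K$ with $L(\xi^\alpha)=m_\alpha\,\xi^\alpha$, where $\xi^\alpha$ is regarded as the distribution $\varphi\mapsto\int\xi^\alpha\varphi(\xi)\,d\xi$ on $\Omega$.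 For $T\in\mathscr D'(\tilde\Omega)$ and $\varphi\in\mathscr D(\tilde\Omega)$ consider the function $y\mapsto T_x\varphi(xy)$, defined for $y\in\mathbb R_*^d$ (then $\varphi(\cdot\,y)\in\mathscr D(\tilde\Omega)$). We say that it belongs to $\mathscr D(\tilde\Omega)$ (or to $\mathscr D(\Omega)$) if it is the restriction to $\mathbb R_*^d$ of a function $\psi$ in that space; this $\psi$ is unique because $\mathbb R_*^d$ is dense in $\mathbb R^d$, and it is again denoted by $T_x\varphi(x\,\cdot)$. Let $\mathscr D'_H(\Omega)$ be the set of all $T\in\mathscr D'(\tilde\Omega)$ such that 1. $T_x\varphi(x\,\cdot)\in\mathscr D(\tilde\Omega)$ for all $\varphi\in\mathscr D(\tilde\Omega)$; 2. $\operatorname{supp}T\subset\mathbb R_*^d$, and for every compact $K\subset\Omega$ the set $(1/\operatorname{supp}T)\,K=\{(1/x)k: x\in\operatorname{supp}T,\ k\in K\}$ is relatively compact in $\Omega$, i.e. contained in a compact subset of $\Omega$. **Theorem.** For every Hadamard operator $L$ on $\mathscr D'(\Omega)$ there is $T\in\mathscr D'_H(\Omega)$ such that $L(S)=S\star T$ for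 all $S\in\mathscr D'(\Omega)$. That is, for every $\varphi\in\mathscr D(\Omega)$ the function $T_x\varphi(x\,\cdot)$ belongs to $\mathscr D(\Omega)$, and $$(L(S))(\varphi)=S_y\big(T_x\varphi(xy)\big)\qquad\text{for all }S\in\mathscr D'(\Omega),\ \varphi\in\mathscr D(\Omega).$$ -/

import Mathlib

open TopologicalSpace MeasureTheory
open scoped Distributions Pointwise

namespace HadamardOp

/-- The space `𝓓'(Ω)` of (real or complex) distributions on an open set `Ω ⊆ ℝ^d`: the continuous
linear functionals on the LF-space of test functions, with the strong dual topology (uniform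
convergence on bounded sets), which is Mathlib's topology on `→L`. The space `Fin d → ℝ` carries
the coordinatewise product `x * y`, with unit `1`. -/
abbrev DPrime (𝕜 : Type*) [RCLike 𝕜] {d : ℕ} (Ω : Opens (Fin d → ℝ)) : Type _ :=
  𝓓(Ω, 𝕜) →L[𝕜] 𝕜

/-- The monomial `ξ ↦ ξ^α`, as a scalar valued function on `ℝ^d`. -/
def monomialFun (𝕜 : Type*) [RCLike 𝕜] {d : ℕ} (α : Fin d → ℕ) (x : Fin d → ℝ) : 𝕜 :=
  ∏ i, ((x i : ℝ) : 𝕜) ^ α i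

theorem continuous_monomialFun (𝕜 : Type*) [RCLike 𝕜] {d : ℕ} (α : Fin d → ℕ) :
    Continuous (monomialFun 𝕜 α) := by
  unfold monomialFun
  exact continuous_finsetProd _ fun i _ =>
    (RCLike.continuous_ofReal.comp (continuous_apply i)).pow _

/-- The monomial `ξ^α` as a (regular) distribution on `Ω`, that is `φ ↦ ∫ φ(ξ) ξ^α dξ`. -/
noncomputable def monomial (𝕜 : Type*) [RCLike 𝕜] {d : ℕ} (Ω : Opens (Fin d → ℝ))
    (α : Fin d → ℕ) : DPrime 𝕜 Ω :=
  TestFunction.integralAgainstBilinCLM (ContinuousLinearMap.mul 𝕜 𝕜) volume (monomialFun 𝕜 α)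

theorem monomial_apply (𝕜 : Type*) [RCLike 𝕜] {d : ℕ} (Ω : Opens (Fin d → ℝ))
    (α : Fin d → ℕ) (φ : 𝓓(Ω, 𝕜)) :
    monomial 𝕜 Ω α φ = ∫ x, φ x * monomialFun 𝕜 α x := by
  have h : LocallyIntegrableOn (monomialFun 𝕜 α) (Ω : Set (Fin d → ℝ)) volume :=
    (continuous_monomialFun 𝕜 α).locallyIntegrable.locallyIntegrableOn _
  exact TestFunction.integralAgainstBilinCLM_eq_integral h

/-- A Hadamard operator: a continuous linear operator on `𝓓'(Ω)` for which every monomial is an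
eigenvector. (If `Ω` is nonempty, the monomials are nonzero elements of `𝓓'(Ω)`.) -/
def IsHadamard {𝕜 : Type*} [RCLike 𝕜] {d : ℕ} {Ω : Opens (Fin d → ℝ)}
    (L : DPrime 𝕜 Ω →L[𝕜] DPrime 𝕜 Ω) : Prop :=
  ∀ α : Fin d → ℕ, ∃ m : 𝕜, L (monomial 𝕜 Ω α) = m • monomial 𝕜 Ω α

/-- `ℝ_*^d = (ℝ \ {0})^d`. -/
def RStar (d : ℕ) : Set (Fin d → ℝ) := {a | ∀ i, a i ≠ 0}

theorem inv_mul_cancel_of_mem {d : ℕ} {a : Fin d → ℝ} (ha : a ∈ RStar d) (x : Fin d → ℝ) :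
    a⁻¹ * (a * x) = x := by
  funext i
  simp [inv_mul_cancel_left₀ (ha i)]

theorem mul_inv_cancel_of_mem {d : ℕ} {a : Fin d → ℝ} (ha : a ∈ RStar d) (x : Fin d → ℝ) :
    a * (a⁻¹ * x) = x := by
  funext i
  simp [mul_inv_cancel_left₀ (ha i)]

theorem inv_mem {d : ℕ} {a : Fin d → ℝ} (ha : a ∈ RStar d) : a⁻¹ ∈ RStar d :=
  fun i => inv_ne_zero (ha i)

theorem mul_mem {d : ℕ} {a b : Fin d → ℝ} (ha : a ∈ RStar d) (hb : b ∈ RStar d) :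
    a * b ∈ RStar d :=
  fun i => mul_ne_zero (ha i) (hb i)

/-- The invertible dilation `x ↦ x * a` as a homeomorphism of `ℝ^d`. -/
noncomputable def dilation {d : ℕ} (a : Fin d → ℝ) (ha : a ∈ RStar d) : (Fin d → ℝ) ≃ₜ (Fin d → ℝ) where
  toFun x := x * a
  invFun x := x * a⁻¹
  left_inv x := by
    change x * a * a⁻¹ = x
    rw [mul_comm, mul_comm x a]; exact inv_mul_cancel_of_mem ha x
  right_inv x := by
    change x * a⁻¹ * a = x
    rw [mul_comm, mul_comm x a⁻¹]; exact mul_inv_cancel_of_mem ha x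
  continuous_toFun := by fun_prop
  continuous_invFun := by fun_prop

/-- `Ω̃ = ⋃_{a ∈ ℝ_*^d} a Ω`. -/
def dilationHull {d : ℕ} (Ω : Opens (Fin d → ℝ)) : Opens (Fin d → ℝ) where
  carrier := ⋃ a ∈ RStar d, (fun x => a * x) '' (Ω : Set (Fin d → ℝ))
  is_open' := by
    refine isOpen_biUnion fun a ha => ?_
    have h := (dilation a ha).isOpenMap _ Ω.isOpen
    have e : (fun x => a * x) = ⇑(dilation a ha) := by
      funext x; exact mul_comm a x
    rw [e]; exact h

theorem mem_dilationHull {d : ℕ} {Ω : Opens (Fin d → ℝ)} {x : Fin d → ℝ} :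
    x ∈ dilationHull Ω ↔ ∃ a ∈ RStar d, ∃ w ∈ Ω, a * w = x := by
  change x ∈ (⋃ a ∈ RStar d, (fun x => a * x) '' (Ω : Set (Fin d → ℝ))) ↔ _
  simp

theorem le_dilationHull {d : ℕ} (Ω : Opens (Fin d → ℝ)) : Ω ≤ dilationHull Ω := fun x hx =>
  mem_dilationHull.2 ⟨1, fun _ => one_ne_zero, x, hx, one_mul x⟩

/-- A test function on `Ω` regarded as a test function on `Ω̃`. -/
noncomputable def incl {𝕜 : Type*} [RCLike 𝕜] {d : ℕ} {Ω : Opens (Fin d → ℝ)} (φ : 𝓓(Ω, 𝕜)) :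
    𝓓(dilationHull Ω, 𝕜) where
  toFun := φ
  contDiff' := φ.contDiff
  hasCompactSupport' := φ.hasCompactSupport
  tsupport_subset' := φ.tsupport_subset.trans (le_dilationHull Ω)

/-- The test function `x ↦ φ (x y)` on `Ω̃`, for `φ ∈ 𝓓(Ω̃)` and `y ∈ ℝ_*^d`. -/
noncomputable def dilate {𝕜 : Type*} [RCLike 𝕜] {d : ℕ} {Ω : Opens (Fin d → ℝ)}
    (φ : 𝓓(dilationHull Ω, 𝕜)) (y : Fin d → ℝ) (hy : y ∈ RStar d) :
    𝓓(dilationHull Ω, 𝕜) where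
  toFun x := φ (x * y)
  contDiff' := φ.contDiff.comp (contDiff_id.mul contDiff_const)
  hasCompactSupport' := φ.hasCompactSupport.comp_homeomorph (dilation y hy)
  tsupport_subset' := by
    intro x hx
    have hx' : x * y ∈ tsupport φ :=
      tsupport_comp_subset_preimage φ (dilation y hy).continuous hx
    obtain ⟨a, ha, w, hw, e⟩ := mem_dilationHull.1 (φ.tsupport_subset hx')
    refine mem_dilationHull.2 ⟨y⁻¹ * a, mul_mem (inv_mem hy) ha, w, hw, ?_⟩
    rw [mul_assoc, e, mul_comm x y]
    exact inv_mul_cancel_of_mem hy x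

/-- `f` is the function `y ↦ T_x φ(x y)`. For `T ∈ 𝓓'(Ω̃)` and `φ ∈ 𝓓(Ω̃)` the right-hand side is
defined for `y ∈ ℝ_*^d`; as `ℝ_*^d` is dense, a continuous `f` is determined by this. -/
def IsTransform {𝕜 : Type*} [RCLike 𝕜] {d : ℕ} {Ω : Opens (Fin d → ℝ)}
    (T : DPrime 𝕜 (dilationHull Ω)) (φ : 𝓓(dilationHull Ω, 𝕜)) (f : (Fin d → ℝ) → 𝕜) : Prop :=
  ∀ (y : Fin d → ℝ) (hy : y ∈ RStar d), f y = T (dilate φ y hy)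

/-- The support of `T ∈ 𝓓'(U)`, a relatively closed subset of `U`. (`Distribution.dsupport` is the
closure of this set in `ℝ^d`.) -/
def supp {𝕜 : Type*} [RCLike 𝕜] {d : ℕ} {U : Opens (Fin d → ℝ)} (T : DPrime 𝕜 U) :
    Set (Fin d → ℝ) :=
  Distribution.dsupport T ∩ U

/-- The space `𝓓'_H(Ω)` of all `T ∈ 𝓓'(Ω̃)` such that `y ↦ T_x φ(x y)` is in `𝓓(Ω̃)` for all
`φ ∈ 𝓓(Ω̃)`, the support of `T` is contained in `ℝ_*^d` (so that `1 / supp T` makes sense), and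
`(1 / supp T) K` is relatively compact in `Ω` for every compact `K ⊆ Ω`. -/
structure MemDH {𝕜 : Type*} [RCLike 𝕜] {d : ℕ} {Ω : Opens (Fin d → ℝ)}
    (T : DPrime 𝕜 (dilationHull Ω)) : Prop where
  maps_to : ∀ φ : 𝓓(dilationHull Ω, 𝕜), ∃ ψ : 𝓓(dilationHull Ω, 𝕜), IsTransform T φ ψ
  supp_subset : supp T ⊆ RStar d
  relativelyCompact : ∀ K : Set (Fin d → ℝ), IsCompact K → K ⊆ Ω →
    ∃ K' : Set (Fin d → ℝ), IsCompact K' ∧ K' ⊆ Ω ∧ (supp T)⁻¹ * K ⊆ K'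

/-- `R = S ⋆ T` in `𝓓'(Ω)`, for `S ∈ 𝓓'(Ω)` and `T ∈ 𝓓'(Ω̃)`: for every `φ ∈ 𝓓(Ω)` the function
`y ↦ T_x φ(x y)` is in `𝓓(Ω)` and `R φ = S_y (T_x φ(x y))`. -/
def IsMulConvolution {𝕜 : Type*} [RCLike 𝕜] {d : ℕ} {Ω : Opens (Fin d → ℝ)}
    (S : DPrime 𝕜 Ω) (T : DPrime 𝕜 (dilationHull Ω)) (R : DPrime 𝕜 Ω) : Prop :=
  ∀ φ : 𝓓(Ω, 𝕜), ∃ ψ : 𝓓(Ω, 𝕜), IsTransform T (incl φ) ψ ∧ R φ = S ψ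

end HadamardOp

/-! ### Compact sets of smooth functions with support in a fixed compact set. -/

namespace HadamardOp

open Filter Set
open scoped Topology ContDiff

/-! Since 𝓓(Ω) is semireflexive (`exists_forall_eq_apply`), `L` is the transpose of a linear
operator M on 𝓓(Ω). The eigenvector condition says that the moments of M φ are those of φ multiplied
by m_α. By Weierstrass approximation a compactly supported continuous function is determined by its
moments (`HasMoments.unique`), so this relation pins down M φ. It is invariant under dilations.

A test function on Ω̃ is a finite sum of dilates of test functions on Ω (`exists_decomposition`).
Hence M extends to an operator N on 𝓓(Ω̃) that commutes with dilations, and T φ = (N φ)(1) satisfies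
T_x φ(xy) = (N φ)(y) (`exists_kernel`).

For the support, M sends functions supported in a compact K to functions supported in a common
compact K' (`exists_compact_tsupport_transpose_subset`). So T vanishes on {x | xy ∈ interior K} for
y ∈ ℝ_*^d outside K', which gives both support conditions. -/

theorem tendstoUniformlyOn_of_lipschitzWith {ι X V : Type*} [PseudoMetricSpace X]
    [PseudoMetricSpace V] {K : Set X} (hK : IsCompact K) {C : NNReal} {l : Filter ι} [l.NeBot]
    {f : ι → X → V} {g : X → V} (hf : ∀ᶠ n in l, LipschitzWith C (f n))
    (hpt : ∀ x, Tendsto (fun n => f n x) l (𝓝 (g x))) : TendstoUniformlyOn f g l K := by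
  have hg : LipschitzWith C g := by
    refine LipschitzWith.of_dist_le_mul fun x y => ?_
    refine le_of_tendsto ((hpt x).dist (hpt y)) ?_
    filter_upwards [hf] with n hn using hn.dist_le_mul x y
  rw [Metric.tendstoUniformlyOn_iff]
  intro ε hε
  have hC : 0 < (C : ℝ) + 1 := by positivity
  obtain ⟨t, -, htf, ht⟩ := hK.finite_cover_balls (e := ε / (3 * (C + 1))) (by positivity)
  have hev : ∀ᶠ n in l, ∀ y ∈ t, dist (f n y) (g y) < ε / 3 :=
    (eventually_all_finite htf).2 fun y _ => Metric.tendsto_nhds.1 (hpt y) _ (by positivity)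
  filter_upwards [hev, hf] with n hn hLn x hx
  obtain ⟨y, hy, hxy⟩ := mem_iUnion₂.1 (ht hx)
  have hxy' : C * dist x y ≤ ε / 3 := by
    have h1 : dist x y ≤ ε / (3 * (C + 1)) := (Metric.mem_ball.1 hxy).le
    calc (C : ℝ) * dist x y ≤ (C + 1) * (ε / (3 * (C + 1))) := by gcongr; linarith
      _ = ε / 3 := by field_simp
  have h1 := hg.dist_le_mul x y
  have h2 := hLn.dist_le_mul x y
  have h3 := hn y hy
  have h4 := dist_triangle4 (g x) (g y) (f n y) (f n x)
  rw [dist_comm (g y), dist_comm (f n y) (f n x)] at h4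
  linarith

/-- Makes bounded sets of derivative values relatively compact. -/
theorem finiteDimensional_continuousMultilinearMap {E F : Type*} [NormedAddCommGroup E]
    [NormedSpace ℝ E] [FiniteDimensional ℝ E] [NormedAddCommGroup F] [NormedSpace ℝ F]
    [FiniteDimensional ℝ F] (i : ℕ) : FiniteDimensional ℝ (E [×i]→L[ℝ] F) :=
  FiniteDimensional.of_injective
    (ContinuousMultilinearMap.toMultilinearMapLinear :
      (E [×i]→L[ℝ] F) →ₗ[ℝ] MultilinearMap ℝ (fun _ : Fin i => E) F)
    ContinuousMultilinearMap.toMultilinearMap_injective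

/-- Sets of smooth functions supported in a fixed compact set, all of whose derivatives are
uniformly bounded, are compact. -/
theorem isCompact_setOf_norm_iteratedFDeriv_le {E F : Type*} [NormedAddCommGroup E]
    [NormedSpace ℝ E] [FiniteDimensional ℝ E] [NormedAddCommGroup F] [NormedSpace ℝ F]
    [FiniteDimensional ℝ F] (K : Compacts E) (C : ℕ → ℝ) :
    IsCompact {f : 𝓓_{K}(E, F) | ∀ i x, ‖iteratedFDeriv ℝ i f x‖ ≤ C i} := by
  rw [isCompact_iff_ultrafilter_le_nhds]
  intro U hU
  have hU' : ∀ᶠ f : 𝓓_{K}(E, F) in (U : Filter 𝓓_{K}(E, F)), ∀ i x, ‖iteratedFDeriv ℝ i f x‖ ≤ C i :=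
    le_principal_iff.1 hU
  have hlim : ∀ i x, ∃ g : E [×i]→L[ℝ] F, ‖g‖ ≤ C i ∧
      Tendsto (fun f : 𝓓_{K}(E, F) => iteratedFDeriv ℝ i f x) U (𝓝 g) := by
    intro i x
    have := finiteDimensional_continuousMultilinearMap (E := E) (F := F) i
    have : ProperSpace (E [×i]→L[ℝ] F) := FiniteDimensional.proper_real _
    obtain ⟨g, hg, hle⟩ := isCompact_iff_ultrafilter_le_nhds.1
      (isCompact_closedBall (0 : E [×i]→L[ℝ] F) (C i))
      (U.map fun f : 𝓓_{K}(E, F) => iteratedFDeriv ℝ i f x) (by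
        rw [le_principal_iff]
        change ∀ᶠ f : 𝓓_{K}(E, F) in (U : Filter 𝓓_{K}(E, F)), iteratedFDeriv ℝ i f x ∈ _
        filter_upwards [hU'] with f hf
        simpa using hf i x)
    exact ⟨g, by simpa using hg, hle⟩
  choose g hgC hg using hlim
  have hg0 : ∀ i, ∀ x ∉ K, g i x = 0 := fun i x hx => by
    refine tendsto_nhds_unique (hg i x) (tendsto_const_nhds.congr fun f => ?_)
    exact (f.iteratedFDeriv_zero_on_compl hx).symm
  -- The bound on derivatives of order i + 1 makes those of order i equi-Lipschitz, so their
  -- pointwise limits along `U` are uniform; outside K everything vanishes.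
  have hunif : ∀ i, TendstoUniformly (fun (f : 𝓓_{K}(E, F)) x => iteratedFDeriv ℝ i f x)
      (fun x => g i x) (U : Filter 𝓓_{K}(E, F)) := by
    intro i
    have h1 : TendstoUniformlyOn (fun (f : 𝓓_{K}(E, F)) x => iteratedFDeriv ℝ i f x)
        (fun x => g i x) (U : Filter 𝓓_{K}(E, F)) K := by
      refine tendstoUniformlyOn_of_lipschitzWith K.isCompact (C := (C (i + 1)).toNNReal) ?_ (hg i)
      filter_upwards [hU'] with f hf
      refine lipschitzWith_of_nnnorm_fderiv_le (𝕜 := ℝ)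
        (f.contDiff.differentiable_iteratedFDeriv (by exact_mod_cast ENat.natCast_lt_top i)) fun x => ?_
      rw [← NNReal.coe_le_coe, coe_nnnorm, norm_fderiv_iteratedFDeriv]
      exact (hf _ x).trans (Real.le_coe_toNNReal _)
    rw [Metric.tendstoUniformly_iff]
    intro ε hε
    filter_upwards [Metric.tendstoUniformlyOn_iff.1 h1 ε hε] with f hf x
    by_cases hx : x ∈ K
    · exact hf x hx
    · have : iteratedFDeriv ℝ i f x = 0 := f.iteratedFDeriv_zero_on_compl hx
      simpa [this, hg0 i x hx] using hε
  -- Uniform convergence of all orders allows differentiation of the limit.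
  have htaylor : HasFTaylorSeriesUpTo ∞ (fun x => (g 0 x).curry0) (fun x i => g i x) := by
    refine ⟨fun x => rfl, fun m _ x => ?_, fun m _ => ?_⟩
    · refine hasFDerivAt_of_tendstoUniformly (l := (U : Filter 𝓓_{K}(E, F)))
        (f := fun f x => iteratedFDeriv ℝ m f x)
        (f' := fun f x => (iteratedFDeriv ℝ (m + 1) f x).curryLeft)
        (g' := fun x => (g (m + 1) x).curryLeft) ?_ ?_ (hg m) x
      · exact (continuousMultilinearCurryLeftEquiv ℝ (fun _ : Fin (m + 1) => E)
          F).lipschitz.uniformContinuous.comp_tendstoUniformly (hunif (m + 1))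
      · intro f x
        exact (contDiff_iff_ftaylorSeries.1 f.contDiff).fderiv m
          (by exact_mod_cast ENat.natCast_lt_top m) x
    · refine (hunif m).continuous (Frequently.of_forall fun f => ?_)
      exact f.contDiff.continuous_iteratedFDeriv (by exact_mod_cast le_top)
  let ψ : 𝓓_{K}(E, F) := ⟨fun x => (g 0 x).curry0, htaylor.contDiff, fun x hx => by
    simp [hg0 0 x hx]⟩
  have hψ : ∀ i x, iteratedFDeriv ℝ i ψ x = g i x := fun i x =>
    (htaylor.eq_iteratedFDeriv (by exact_mod_cast le_top) x).symm
  refine ⟨ψ, fun i x => by rw [hψ]; exact hgC i x, ?_⟩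
  rw [(ContDiffMapSupportedIn.isUniformEmbedding_pi_structureMapCLM ℝ).isInducing.nhds_eq_comap,
    ← tendsto_iff_comap, tendsto_pi_nhds]
  intro i
  rw [BoundedContinuousFunction.tendsto_iff_tendstoUniformly]
  have h := hunif i
  simp_rw [← hψ] at h
  simp only [ContinuousLinearMap.pi_apply,
    ContDiffMapSupportedIn.structureMapCLM_top_apply]
  exact h

end HadamardOp

/-! ### Bounded sets of test functions and semireflexivity. -/

namespace HadamardOp

universe u v

open Filter Set
open scoped Topology ContDiff

theorem exists_compact_exhaustion {E : Type*} [NormedAddCommGroup E] [NormedSpace ℝ E]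
    [FiniteDimensional ℝ E] (Ω : Opens E) :
    ∃ K : ℕ → Compacts E, Monotone K ∧ (∀ n, (K n : Set E) ⊆ Ω) ∧
      ∀ C : Set E, IsCompact C → C ⊆ Ω → ∃ n, C ⊆ K n := by
  have : ProperSpace E := FiniteDimensional.proper_real E
  have : LocallyCompactSpace Ω := Ω.isOpen.locallyCompactSpace
  have : SecondCountableTopology E := secondCountable_of_proper
  have : SigmaCompactSpace Ω := sigmaCompactSpace_of_locallyCompact_secondCountable
  let e : CompactExhaustion Ω := default
  refine ⟨fun n => ⟨(↑) '' e n, (e.isCompact n).image continuous_subtype_val⟩,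
    fun m n h => SetLike.coe_subset_coe.1 (image_mono (f := ((↑) : Ω → E)) (e.subset h)), fun n => by rintro _ ⟨x, -, rfl⟩; exact x.2,
    fun C hC hCΩ => ?_⟩
  have hC' : IsCompact ((↑) ⁻¹' C : Set Ω) := by
    rw [Subtype.isCompact_iff]
    convert hC
    exact image_preimage_eq_of_subset fun x hx => ⟨⟨x, hCΩ hx⟩, rfl⟩
  obtain ⟨n, hn⟩ := e.exists_superset_of_isCompact hC'
  exact ⟨n, fun x hx => ⟨⟨x, hCΩ hx⟩, hn hx, rfl⟩⟩

/-- Forward substitution in a lower triangular system; it supplies the coefficients of a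
distribution with prescribed values on a sequence of test functions. -/
theorem exists_forall_sum_range_eq {𝕜 : Type*} [Field 𝕜] (a : ℕ → ℕ → 𝕜) (ha : ∀ n, a n n ≠ 0)
    (b : ℕ → 𝕜) : ∃ c : ℕ → 𝕜, ∀ n, ∑ m ∈ Finset.range (n + 1), c m * a n m = b n := by
  let c : ℕ → 𝕜 := fun n => Nat.strongRec (motive := fun _ => 𝕜) (fun n ih =>
    (b n - ∑ m : Fin n, ih m m.2 * a n m) / a n n) n
  have hc : ∀ n, c n = (b n - ∑ m : Fin n, c m * a n m) / a n n := fun n => by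
    simp only [c]
    rw [Nat.strongRec]
  refine ⟨c, fun n => ?_⟩
  rw [Finset.sum_range_succ, hc n, div_mul_cancel₀ _ (ha n),
    Fin.sum_univ_eq_sum_range (fun m => c m * a n m)]
  ring

section

variable {𝕜 : Type (max u v)} [RCLike 𝕜] {E : Type u} [NormedAddCommGroup E] [NormedSpace ℝ E] {Ω : Opens E}

/-- The Dirac distribution `δ_x`. -/
noncomputable def dirac (𝕜 : Type (max u v)) [RCLike 𝕜] (Ω : Opens E) (x : E) : 𝓓(Ω, 𝕜) →L[𝕜] 𝕜 where
  toFun φ := φ x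
  map_add' _ _ := rfl
  map_smul' _ _ := rfl
  cont := continuous_eval_const x

@[simp]
theorem dirac_apply (x : E) (φ : 𝓓(Ω, 𝕜)) : dirac 𝕜 Ω x φ = φ x := rfl

/-- Differentiation is continuous and so preserves boundedness. The induction replaces `F` by `E
→L[ℝ] F`, whence the universe `max u v`. -/
theorem exists_norm_iteratedFDeriv_le_of_isVonNBounded {F : Type (max u v)}
    [NormedAddCommGroup F] [NormedSpace ℝ F] [NormedSpace 𝕜 F] [IsScalarTower ℝ 𝕜 F]
    {B : Set 𝓓(Ω, F)} (hB : Bornology.IsVonNBounded 𝕜 B) (i : ℕ) :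
    ∃ C : ℝ, ∀ φ ∈ B, ∀ x, ‖iteratedFDeriv ℝ i φ x‖ ≤ C := by
  induction i generalizing F with
  | zero =>
    have h := (NormedSpace.isVonNBounded_iff 𝕜).1 (hB.image (σ := RingHom.id 𝕜)
      (TestFunction.toBoundedContinuousFunctionCLM (Ω := Ω) (F := F) (n := ⊤) 𝕜))
    obtain ⟨C, hC⟩ := h.exists_norm_le
    refine ⟨C, fun φ hφ x => ?_⟩
    rw [norm_iteratedFDeriv_zero]
    exact (BoundedContinuousFunction.norm_coe_le_norm (φ : BoundedContinuousFunction E F) x).trans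
      (hC _ ⟨φ, hφ, rfl⟩)
  | succ i ih =>
    obtain ⟨C, hC⟩ := ih (hB.image (σ := RingHom.id 𝕜)
      (TestFunction.fderivCLM (Ω := Ω) (F := F) 𝕜 ⊤ ⊤))
    refine ⟨C, fun φ hφ x => ?_⟩
    have h := hC _ ⟨φ, hφ, rfl⟩ x
    rwa [TestFunction.fderivCLM_apply_of_le φ le_top, norm_iteratedFDeriv_fderiv] at h

variable [FiniteDimensional ℝ E]

/-- The elements of a weakly bounded set of test functions are supported in a common compact
set. -/
theorem exists_compact_forall_tsupport_subset {B : Set 𝓓(Ω, 𝕜)}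
    (hB : ∀ S : 𝓓(Ω, 𝕜) →L[𝕜] 𝕜, ∃ C : ℝ, ∀ φ ∈ B, ‖S φ‖ ≤ C) :
    ∃ K : Compacts E, (K : Set E) ⊆ Ω ∧ ∀ φ ∈ B, tsupport φ ⊆ K := by
  by_contra! H
  obtain ⟨K, hKmono, hKΩ, hK⟩ := exists_compact_exhaustion Ω
  have step : ∀ N, ∃ φ ∈ B, ∃ x, x ∉ K N ∧ φ x ≠ 0 ∧ ∃ N' > N, tsupport φ ⊆ K N' := by
    intro N
    obtain ⟨φ, hφ, hN⟩ := H (K N) (hKΩ N)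
    obtain ⟨x, hx, hxK⟩ : ∃ x, φ x ≠ 0 ∧ x ∉ K N := by
      by_contra! h
      exact hN (closure_minimal h (K N).isCompact.isClosed)
    obtain ⟨n, hn⟩ := hK _ φ.hasCompactSupport φ.tsupport_subset
    exact ⟨φ, hφ, x, hxK, hx, max n (N + 1), by simp,
      hn.trans (hKmono (le_max_left _ _))⟩
  choose φ hφB x hxK hφx next hnext hsupp using step
  let N : ℕ → ℕ := fun n => next^[n] 0
  have hN1 : ∀ n, N (n + 1) = next (N n) := fun n => Function.iterate_succ_apply' next n 0
  have hNmono : StrictMono N := strictMono_nat_of_lt_succ fun n => by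
    rw [hN1]; exact hnext _
  have hvanish : ∀ (f : E → 𝕜) (j : ℕ), Function.support f ⊆ K j → ∀ m, j ≤ N m → f (x (N m)) = 0 := by
    intro f j hf m hm
    by_contra h
    exact hxK (N m) (hKmono hm (hf h))
  obtain ⟨c, hc⟩ := exists_forall_sum_range_eq (fun n m => φ (N n) (x (N m)))
    (fun n => hφx (N n)) (fun n => (n : 𝕜))
  choose j hj using fun (C : Compacts E) (hC : (C : Set E) ⊆ Ω) => hK C C.isCompact hC
  have hsum : ∀ (f : E → 𝕜) (J : ℕ), (∀ m, J ≤ m → f (x (N m)) = 0) →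
      ∑' m, c m * f (x (N m)) = ∑ m ∈ Finset.range J, c m * f (x (N m)) := fun f J hJ =>
    tsum_eq_sum fun m hm => by rw [hJ m (by simpa using hm), mul_zero]
  -- The points x (N m) leave every compact subset of Ω, so on functions supported in C this is a
  -- finite sum of Dirac distributions.
  let S : 𝓓(Ω, 𝕜) →L[𝕜] 𝕜 := TestFunction.limitCLM 𝕜 (fun f => ∑' m, c m * f (x (N m)))
    (fun C hC => (∑ m ∈ Finset.range (j C hC), c m • dirac 𝕜 Ω (x (N m))) ∘L
      TestFunction.ofSupportedInCLM 𝕜 hC) (fun C hC f => by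
      rw [hsum (TestFunction.ofSupportedIn hC f) (j C hC) fun m hm => hvanish _ (j C hC) (f.support_subset.trans (hj C hC)) m
        (hm.trans (hNmono.le_apply))]
      simp)
  -- φ (N n) is supported in K (N (n + 1)), so it vanishes at x (N m) for m > n: the system for c is
  -- triangular.
  have hS : ∀ n, S (φ (N n)) = n := fun n => by
    change ∑' m, c m * φ (N n) (x (N m)) = n
    rw [hsum (φ (N n)) (n + 1) fun m hm => hvanish _ (N (n + 1)) ?_ m (hNmono.monotone hm)]
    · exact hc n
    · rw [hN1]
      exact (subset_tsupport _).trans (hsupp _)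
  obtain ⟨C, hC⟩ := hB S
  obtain ⟨n, hn⟩ := exists_nat_gt C
  have h := hC _ (hφB (N n))
  rw [hS, RCLike.norm_natCast] at h
  linarith

/-- The space of test functions is semireflexive. -/
theorem exists_forall_eq_apply (F : (𝓓(Ω, 𝕜) →L[𝕜] 𝕜) →L[𝕜] 𝕜) :
    ∃ ψ : 𝓓(Ω, 𝕜), ∀ S : 𝓓(Ω, 𝕜) →L[𝕜] 𝕜, F S = S ψ := by
  obtain ⟨⟨B, V⟩, ⟨hB, hV⟩, hBV⟩ := (ContinuousLinearMap.hasBasis_nhds_zero (𝕜₁ := 𝕜) (𝕜₂ := 𝕜)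
    (σ := RingHom.id 𝕜) (E := 𝓓(Ω, 𝕜)) (F := 𝕜)).mem_iff.1
    (F.continuous.tendsto' 0 0 (map_zero F) (Metric.closedBall_mem_nhds 0 one_pos))
  obtain ⟨ε, hε, hεV⟩ := Metric.nhds_basis_closedBall.mem_iff.1 hV
  have hF : ∀ S : 𝓓(Ω, 𝕜) →L[𝕜] 𝕜, (∀ φ ∈ B, ‖S φ‖ ≤ ε) → ‖F S‖ ≤ 1 := fun S hS => by
    simpa using hBV (fun φ hφ => hεV (by simpa using hS φ hφ) : S ∈ {f | ∀ x ∈ B, f x ∈ V})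
  obtain ⟨K, hKΩ, hBK⟩ := exists_compact_forall_tsupport_subset (B := B) fun S => by
    obtain ⟨C, hC⟩ := ((NormedSpace.isVonNBounded_iff 𝕜).1 (hB.image S)).exists_norm_le
    exact ⟨C, fun φ hφ => hC _ ⟨φ, hφ, rfl⟩⟩
  choose C hC using exists_norm_iteratedFDeriv_le_of_isVonNBounded hB
  -- A compact absolutely convex set with B ⊆ ε A. The absolute value keeps 0 in A, since C i may be
  -- negative when B is empty.
  let A : Set 𝓓_{K}(E, 𝕜) := {f | ∀ i x, ‖iteratedFDeriv ℝ i f x‖ ≤ |C i| / ε}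
  have hA : IsCompact A := isCompact_setOf_norm_iteratedFDeriv_le K _
  have hAsmul : ∀ c : 𝕜, ‖c‖ = 1 → ∀ g ∈ A, c • g ∈ A := fun c hc g hg i x => by
    rw [FunLike.coe_smul, iteratedFDeriv_const_smul_apply
      (g.contDiff.contDiffAt.of_le (by exact_mod_cast le_top)), norm_smul, hc, one_mul]
    exact hg i x
  have hAconv : Convex ℝ A := by
    intro f hf g hg a b ha hb hab i x
    have hsmul : ∀ (c : ℝ) (f : 𝓓_{K}(E, 𝕜)), iteratedFDeriv ℝ i (c • ⇑f) x =
        c • iteratedFDeriv ℝ i f x := fun c f =>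
      iteratedFDeriv_const_smul_apply (f.contDiff.contDiffAt.of_le (by exact_mod_cast le_top))
    have hadd : iteratedFDeriv ℝ i (a • ⇑f + b • ⇑g) x =
        iteratedFDeriv ℝ i (a • ⇑f) x + iteratedFDeriv ℝ i (b • ⇑g) x :=
      iteratedFDeriv_add_apply
        ((f.contDiff.const_smul a).contDiffAt.of_le (by exact_mod_cast le_top))
        ((g.contDiff.const_smul b).contDiffAt.of_le (by exact_mod_cast le_top))
    rw [FunLike.coe_add, FunLike.coe_smul, FunLike.coe_smul, hadd, hsmul, hsmul]
    have h := convex_closedBall (0 : E [×i]→L[ℝ] 𝕜) (|C i| / ε)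
      (by simpa using hf i x) (by simpa using hg i x) ha hb hab
    simpa using h
  have h0A : (0 : 𝓓_{K}(E, 𝕜)) ∈ A := fun i x => by
    rw [FunLike.coe_zero, iteratedFDeriv_zero]
    simp only [Pi.zero_apply, norm_zero]
    positivity
  have hBA : ∀ φ ∈ B, ∃ g ∈ A, φ = (ε : 𝕜) • TestFunction.ofSupportedIn hKΩ g := fun φ hφ => by
    let f : 𝓓_{K}(E, 𝕜) := ContDiffMapSupportedIn.of_support_subset φ.contDiff
      ((subset_tsupport φ).trans (hBK φ hφ))
    refine ⟨(ε : 𝕜)⁻¹ • f, fun i x => ?_, ?_⟩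
    · rw [FunLike.coe_smul, iteratedFDeriv_const_smul_apply
        (f.contDiff.contDiffAt.of_le (by exact_mod_cast le_top)), norm_smul, norm_inv,
        RCLike.norm_ofReal, abs_of_pos hε, ← div_eq_inv_mul]
      gcongr
      exact (hC i φ hφ x).trans (le_abs_self _)
    · ext x
      have : (ε : 𝕜) ≠ 0 := by exact_mod_cast hε.ne'
      change φ x = ε * ((ε : 𝕜)⁻¹ * φ x)
      rw [mul_inv_cancel_left₀ this]
  let ι := TestFunction.ofSupportedInCLM 𝕜 (n := ⊤) (F := 𝕜) hKΩ
  suffices h : (A ∩ ⋂ S : 𝓓(Ω, 𝕜) →L[𝕜] 𝕜, {f | S (ι f) = F S}).Nonempty by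
    obtain ⟨f, -, hf⟩ := h
    exact ⟨ι f, fun S => (mem_iInter.1 hf S).symm⟩
  -- By compactness of A it suffices to represent F on finitely many distributions at a time; there
  -- Hahn–Banach applies in a finite-dimensional space.
  refine hA.inter_iInter_nonempty _ (fun S => isClosed_eq (by fun_prop) continuous_const)
    fun u => ?_
  let Φ : 𝓓_{K}(E, 𝕜) →L[𝕜] (u → 𝕜) := ContinuousLinearMap.pi fun S => S.1 ∘L ι
  suffices h : (fun S : u => F S.1) ∈ Φ '' A by
    obtain ⟨f, hfA, hf⟩ := h
    exact ⟨f, hfA, mem_iInter₂.2 fun S hS => congrFun hf ⟨S, hS⟩⟩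
  by_contra hv
  obtain ⟨f, r, hfr, hrv⟩ := RCLike.geometric_hahn_banach_closed_point (𝕜 := 𝕜)
    (hAconv.is_linear_image (f := Φ) ⟨map_add Φ, fun c x => (Φ.restrictScalars ℝ).map_smul c x⟩)
    (hA.image Φ.continuous).isClosed hv
  classical
  let S₀ : 𝓓(Ω, 𝕜) →L[𝕜] 𝕜 := ∑ S : u, f (Pi.single S 1) • S.1
  have hf : ∀ w : u → 𝕜, f w = ∑ S : u, f (Pi.single S 1) * w S := fun w => by
    conv_lhs => rw [pi_eq_sum_univ' w]
    simp [map_sum, mul_comm]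
  have hfS : ∀ g, f (Φ g) = S₀ (ι g) := fun g => by
    rw [hf]
    simp [S₀, Φ]
  have hfF : f (fun S : u => F S.1) = F S₀ := by
    rw [hf]
    simp [S₀]
  have hr : 0 < r := by simpa using hfr 0 ⟨0, h0A, map_zero Φ⟩
  -- A is stable under scalars of norm one, so the bound on real parts is a bound on norms.
  have hS₀A : ∀ g ∈ A, ‖S₀ (ι g)‖ < r := fun g hg => by
    obtain ⟨c, hc, hcg⟩ := RCLike.exists_norm_eq_mul_self (S₀ (ι g))
    have h := hfr _ ⟨c • g, hAsmul c hc g hg, rfl⟩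
    rwa [hfS, map_smul, map_smul, smul_eq_mul, ← hcg, RCLike.ofReal_re] at h
  -- S₀ / r is at most ε on B, which forces ‖F S₀‖ ≤ r against the separation.
  have h1 : ‖F ((r : 𝕜)⁻¹ • S₀)‖ ≤ 1 := hF _ fun φ hφ => by
    obtain ⟨g, hg, rfl⟩ := hBA φ hφ
    rw [smul_apply, map_smul, norm_smul, norm_smul, norm_inv,
      RCLike.norm_ofReal, RCLike.norm_ofReal, abs_of_pos hr, abs_of_pos hε]
    have := (hS₀A g hg).le
    calc r⁻¹ * (ε * ‖S₀ (ι g)‖) ≤ r⁻¹ * (ε * r) := by gcongr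
      _ = ε := by field_simp
  rw [map_smul, norm_smul, norm_inv, RCLike.norm_ofReal, abs_of_pos hr, inv_mul_le_one₀ hr] at h1
  rw [hfF] at hrv
  exact absurd (hrv.trans_le (RCLike.re_le_norm _)) h1.not_gt

end

end HadamardOp

/-! ### Moments determine compactly supported functions. -/

namespace HadamardOp

open Filter Set
open scoped Topology ContDiff

theorem exists_mvPolynomial_forall_abs_sub_lt {ι : Type*} {K : Set (ι → ℝ)}
    (hK : IsCompact K) {g : (ι → ℝ) → ℝ} (hg : ContinuousOn g K) {ε : ℝ} (hε : 0 < ε) :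
    ∃ P : MvPolynomial ι ℝ, ∀ x ∈ K, |g x - MvPolynomial.eval x P| < ε := by
  have : CompactSpace K := isCompact_iff_compactSpace.1 hK
  let coord : ι → C(K, ℝ) := fun i => ⟨fun x => x.1 i, (continuous_apply i).comp continuous_subtype_val⟩
  let ev : MvPolynomial ι ℝ →ₐ[ℝ] C(K, ℝ) := MvPolynomial.aeval coord
  have hev : ∀ P (x : K), ev P x = MvPolynomial.eval x.1 P := fun P x => by
    induction P using MvPolynomial.induction_on with
    | C a => simp [ev]
    | add p q hp hq => simp [hp, hq]
    | mul_X p i hp => simp [hp]; simp [ev, coord]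
  have hsep : ev.range.SeparatesPoints := by
    intro x y hxy
    obtain ⟨i, hi⟩ := Function.ne_iff.1 (Subtype.coe_ne_coe.2 hxy)
    exact ⟨coord i, ⟨coord i, ⟨MvPolynomial.X i, by simp [ev]⟩, rfl⟩, hi⟩
  have hdense : (⟨K.domRestrict g, hg.domRestrict⟩ : C(K, ℝ)) ∈ ev.range.topologicalClosure := by
    rw [ContinuousMap.subalgebra_topologicalClosure_eq_top_of_separatesPoints _ hsep]
    trivial
  obtain ⟨_, ⟨P, rfl⟩, hP⟩ := Metric.mem_closure_iff.1 hdense ε hε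
  refine ⟨P, fun x hx => ?_⟩
  have h := (ContinuousMap.dist_lt_iff hε).1 hP ⟨x, hx⟩
  rw [show ev.toRingHom P ⟨x, hx⟩ = _ from hev P ⟨x, hx⟩] at h
  simpa [Real.dist_eq] using h

/-- A compactly supported continuous function all of whose moments vanish is zero. -/
theorem eq_zero_of_forall_integral_mul_prod_pow_eq_zero {ι : Type*} [Fintype ι]
    {g : (ι → ℝ) → ℝ} (hg : Continuous g) (hgc : HasCompactSupport g)
    (h : ∀ α : ι → ℕ, ∫ x, g x * ∏ i, x i ^ α i = 0) : g = 0 := by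
  have hint : ∀ f : (ι → ℝ) → ℝ, Continuous f → Integrable fun x => g x * f x := fun f hf =>
    (hg.mul hf).integrable_of_hasCompactSupport hgc.mul_right
  have hpoly : ∀ P : MvPolynomial ι ℝ, ∫ x, g x * MvPolynomial.eval x P = 0 := fun P => by
    simp_rw [MvPolynomial.eval_eq', Finset.mul_sum, mul_left_comm (g _)]
    rw [integral_finsetSum _ fun α _ => (hint _ (by fun_prop)).const_mul _]
    exact Finset.sum_eq_zero fun α _ => by rw [integral_const_mul, h, mul_zero]
  -- ∫ g² = ∫ g (g - P) for every polynomial P, and P may be uniformly close to g on the support of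
  -- g.
  have hsq : ∫ x, g x * g x ≤ 0 := by
    refine le_of_forall_pos_le_add fun ε hε => ?_
    have hI : 0 ≤ ∫ x, |g x| := integral_nonneg fun x => abs_nonneg _
    obtain ⟨P, hP⟩ := exists_mvPolynomial_forall_abs_sub_lt (K := tsupport g) hgc hg.continuousOn
      (ε := ε / ((∫ x, |g x|) + 1)) (by positivity)
    have hPc : Continuous fun x => MvPolynomial.eval x P := MvPolynomial.continuous_eval P
    have hle : ∀ x, g x * (g x - MvPolynomial.eval x P) ≤ |g x| * (ε / ((∫ x, |g x|) + 1)) := by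
      intro x
      by_cases hx : x ∈ tsupport g
      · refine (le_abs_self _).trans ?_
        rw [abs_mul]
        exact mul_le_mul_of_nonneg_left (hP x hx).le (abs_nonneg _)
      · simp [image_eq_zero_of_notMem_tsupport hx]
    calc ∫ x, g x * g x = ∫ x, g x * (g x - MvPolynomial.eval x P) := by
          simp_rw [mul_sub]
          rw [integral_sub (hint _ hg) (hint _ hPc), hpoly, sub_zero]
      _ ≤ ∫ x, |g x| * (ε / ((∫ x, |g x|) + 1)) :=
          integral_mono (hint _ (hg.sub hPc))
            ((hg.integrable_of_hasCompactSupport hgc).abs.mul_const _) hle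
      _ = ((∫ x, |g x|) / ((∫ x, |g x|) + 1)) * ε := by rw [integral_mul_const]; ring
      _ ≤ 1 * ε := by
          gcongr
          rw [div_le_one (by positivity)]
          linarith
      _ = 0 + ε := by ring
  by_contra hne
  obtain ⟨x, hx⟩ := Function.ne_iff.1 hne
  exact hsq.not_gt (Continuous.integral_pos_of_hasCompactSupport_nonneg_nonzero (hg.mul hg)
    hgc.mul_right (fun x => mul_self_nonneg _) (mul_self_pos.2 hx).ne')

section

variable {𝕜 : Type*} [RCLike 𝕜] {d : ℕ}

/-- The moments of `ψ` arise from those of `φ` through multiplication by `m`. -/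
def HasMoments (m : (Fin d → ℕ) → 𝕜) (φ ψ : (Fin d → ℝ) → 𝕜) : Prop :=
  ∀ α, ∫ x, ψ x * monomialFun 𝕜 α x = m α * ∫ x, φ x * monomialFun 𝕜 α x

theorem integrable_mul_monomialFun {φ : (Fin d → ℝ) → 𝕜} (hφ : Continuous φ)
    (hφc : HasCompactSupport φ) (α : Fin d → ℕ) :
    Integrable fun x => φ x * monomialFun 𝕜 α x :=
  (hφ.mul (continuous_monomialFun 𝕜 α)).integrable_of_hasCompactSupport hφc.mul_right

/-- Monomials are real valued, so the real and imaginary parts of ψ₁ - ψ₂ separately have vanishing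
moments. -/
theorem HasMoments.unique {m : (Fin d → ℕ) → 𝕜} {φ ψ₁ ψ₂ : (Fin d → ℝ) → 𝕜}
    (h₁ : HasMoments m φ ψ₁) (h₂ : HasMoments m φ ψ₂) (hc₁ : Continuous ψ₁) (hc₂ : Continuous ψ₂)
    (hs₁ : HasCompactSupport ψ₁) (hs₂ : HasCompactSupport ψ₂) : ψ₁ = ψ₂ := by
  have hm : ∀ α (x : Fin d → ℝ), monomialFun 𝕜 α x = ((∏ i, x i ^ α i : ℝ) : 𝕜) := fun α x => by
    simp [monomialFun]
  have hc : Continuous (ψ₁ - ψ₂) := hc₁.sub hc₂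
  have hs : HasCompactSupport (ψ₁ - ψ₂) := hs₁.sub hs₂
  have h0 : ∀ α, ∫ x, (ψ₁ - ψ₂) x * monomialFun 𝕜 α x = 0 := fun α => by
    simp_rw [Pi.sub_apply, sub_mul]
    rw [integral_sub (integrable_mul_monomialFun hc₁ hs₁ α)
      (integrable_mul_monomialFun hc₂ hs₂ α), h₁, h₂, sub_self]
  have hre : (fun x => RCLike.re ((ψ₁ - ψ₂) x)) = 0 := by
    refine eq_zero_of_forall_integral_mul_prod_pow_eq_zero (RCLike.continuous_re.comp hc)
      (hs.comp_left (g := RCLike.re) (map_zero _)) fun α => ?_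
    have h := integral_re (integrable_mul_monomialFun hc hs α)
    rw [h0 α, map_zero] at h
    rw [← h]
    refine integral_congr_ae (.of_forall fun x => ?_)
    simp only [hm, RCLike.re_mul_ofReal]
  have him : (fun x => RCLike.im ((ψ₁ - ψ₂) x)) = 0 := by
    refine eq_zero_of_forall_integral_mul_prod_pow_eq_zero (RCLike.continuous_im.comp hc)
      (hs.comp_left (g := RCLike.im) (map_zero _)) fun α => ?_
    have h := integral_im (integrable_mul_monomialFun hc hs α)
    rw [h0 α, map_zero] at h
    rw [← h]
    refine integral_congr_ae (.of_forall fun x => ?_)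
    simp only [hm, RCLike.im_mul_ofReal]
  funext x
  refine sub_eq_zero.1 (RCLike.ext ?_ ?_)
  · simpa using congrFun hre x
  · simpa using congrFun him x

theorem HasMoments.sum {m : (Fin d → ℕ) → 𝕜} {κ : Type*} (s : Finset κ)
    {φ ψ : κ → (Fin d → ℝ) → 𝕜} (h : ∀ i ∈ s, HasMoments m (φ i) (ψ i))
    (hφ : ∀ i ∈ s, Continuous (φ i)) (hφs : ∀ i ∈ s, HasCompactSupport (φ i))
    (hψ : ∀ i ∈ s, Continuous (ψ i)) (hψs : ∀ i ∈ s, HasCompactSupport (ψ i)) :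
    HasMoments m (fun x => ∑ i ∈ s, φ i x) (fun x => ∑ i ∈ s, ψ i x) := by
  intro α
  simp_rw [Finset.sum_mul]
  rw [integral_finsetSum _ fun i hi => integrable_mul_monomialFun (hφ i hi) (hφs i hi) α,
    integral_finsetSum _ fun i hi => integrable_mul_monomialFun (hψ i hi) (hψs i hi) α,
    Finset.mul_sum]
  exact Finset.sum_congr rfl fun i hi => h i hi α

theorem exists_integral_comp_mul_right {a : Fin d → ℝ} (ha : a ∈ RStar d) :
    ∃ c : ℝ, ∀ g : (Fin d → ℝ) → 𝕜, ∫ x, g (x * a) = c • ∫ x, g x := by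
  let f : (Fin d → ℝ) →ₗ[ℝ] (Fin d → ℝ) := LinearMap.mulRight ℝ a
  have hbij : Function.Bijective f := (dilation a ha).bijective
  have hdet : LinearMap.det f ≠ 0 :=
    ((LinearEquiv.ofBijective f hbij).isUnit_det').ne_zero
  refine ⟨(ENNReal.ofReal |(LinearMap.det f)⁻¹|).toReal, fun g => ?_⟩
  rw [← integral_smul_measure, ← Measure.map_linearMap_addHaar_eq_smul_addHaar volume hdet]
  exact ((dilation a ha).toMeasurableEquiv.measurableEmbedding.integral_map g).symm

/-- Monomials are multiplicative, so dilation by a multiplies the α-th moments of φ and ψ by the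
same factor c / a^α. -/
theorem HasMoments.comp_mul_right {m : (Fin d → ℕ) → 𝕜} {φ ψ : (Fin d → ℝ) → 𝕜}
    (h : HasMoments m φ ψ) {a : Fin d → ℝ} (ha : a ∈ RStar d) :
    HasMoments m (fun x => φ (x * a)) (fun x => ψ (x * a)) := by
  obtain ⟨c, hc⟩ := exists_integral_comp_mul_right (𝕜 := 𝕜) ha
  intro α
  have hne : monomialFun 𝕜 α a ≠ 0 :=
    Finset.prod_ne_zero_iff.2 fun i _ => pow_ne_zero _ (RCLike.ofReal_ne_zero.2 (ha i))
  have hmul : ∀ x, monomialFun 𝕜 α (x * a) = monomialFun 𝕜 α x * monomialFun 𝕜 α a := fun x => by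
    simp [monomialFun, mul_pow, Finset.prod_mul_distrib]
  have key : ∀ f : (Fin d → ℝ) → 𝕜, (∫ x, f (x * a) * monomialFun 𝕜 α x) * monomialFun 𝕜 α a =
      c • ∫ x, f x * monomialFun 𝕜 α x := fun f => by
    rw [← integral_mul_const, ← hc]
    simp_rw [hmul, mul_assoc]
  apply mul_right_cancel₀ hne
  rw [key, mul_assoc, key, h α, mul_smul_comm]

end

end HadamardOp

/-! ### Decomposition of test functions on Ω̃ into dilates. -/

namespace HadamardOp

open Filter Set
open scoped Topology ContDiff Manifold

section

variable {𝕜 : Type*} [RCLike 𝕜] {E : Type*} [NormedAddCommGroup E] [NormedSpace ℝ E]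

/-- Composition of functions supported in `K` with a linear map for which the preimage of `K` is
contained in `K'`. -/
noncomputable def compLinearCLM (𝕜 : Type*) [RCLike 𝕜] {K K' : Compacts E}
    (g : E →L[ℝ] E) (h : g ⁻¹' K ⊆ K') : 𝓓_{K}(E, 𝕜) →L[𝕜] 𝓓_{K'}(E, 𝕜) :=
  ContDiffMapSupportedIn.mkCLM 𝕜 (fun f x => f (g x)) (fun _ _ _ => rfl) (fun _ _ _ => rfl)
    (fun f => f.contDiff.comp g.contDiff) (fun f x hx => f.zero_on_compl fun hx' => hx (h hx'))
    (fun i _ => ⟨{i}, ‖g‖ ^ i, by positivity, fun f x _ => by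
      have h1 := ContinuousLinearMap.iteratedFDeriv_comp_right g f.contDiff x (i := i)
        (by exact_mod_cast le_top)
      rw [Function.comp_def] at h1
      rw [h1]
      refine (ContinuousMultilinearMap.norm_compContinuousLinearMap_le _ _).trans ?_
      rw [Finset.sup_singleton, Finset.prod_const, Finset.card_univ, Fintype.card_fin, mul_comm]
      gcongr
      exact ContDiffMapSupportedIn.norm_iteratedFDeriv_apply_le_seminorm_top 𝕜⟩)

/-- Multiplication of functions supported in `K` by a smooth function `χ` such that
`K ∩ tsupport χ` is contained in `K'`. -/
noncomputable def mulSmoothCLM {K K' : Compacts E} {χ : E → 𝕜} (hχ : ContDiff ℝ ∞ χ)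
    (h : (K : Set E) ∩ tsupport χ ⊆ K') : 𝓓_{K}(E, 𝕜) →L[𝕜] 𝓓_{K'}(E, 𝕜) where
  toFun f := ⟨fun x => f x * χ x, f.contDiff.mul hχ, fun x hx => by
    by_cases h1 : x ∈ K
    · have : x ∉ tsupport χ := fun h2 => hx (h ⟨h1, h2⟩)
      simp [image_eq_zero_of_notMem_tsupport this]
    · have : f x = 0 := f.zero_on_compl h1
      simp [this]⟩
  map_add' f g := by ext x; exact add_mul _ _ _
  map_smul' c f := by ext x; exact mul_assoc _ _ _
  cont := by
    rw [ContDiffMapSupportedIn.continuous_iff_comp]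
    intro i
    refine ((ContDiffMapSupportedIn.structureMapCLM ℝ ⊤ i).continuous.comp
      (ContDiffMapSupportedIn.bilinLeftCLM (n := ⊤) (K := K) (ContinuousLinearMap.mul 𝕜 𝕜)
        hχ).continuous).congr fun f => ?_
    ext1 x
    exact (congrFun (ContDiffMapSupportedIn.structureMapCLM_top_apply ℝ _) x).trans
      (congrFun (ContDiffMapSupportedIn.structureMapCLM_top_apply ℝ _) x).symm

end

variable {𝕜 : Type*} [RCLike 𝕜] {d : ℕ} {Ω : Opens (Fin d → ℝ)}

/-- Test functions on `Ω̃` with support in a fixed compact set decompose, linearly and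
continuously, into finitely many dilations of test functions on `Ω`. -/
theorem exists_decomposition (K : Compacts (Fin d → ℝ))
    (hK : (K : Set (Fin d → ℝ)) ⊆ dilationHull Ω) :
    ∃ (t : Finset (RStar d)) (P : RStar d → 𝓓_{K}(Fin d → ℝ, 𝕜) →L[𝕜] 𝓓(Ω, 𝕜)),
      ∀ f x, f x = ∑ a ∈ t, P a f (x * a.1) := by
  have hopen : ∀ a : RStar d, IsOpen (dilation a.1 a.2 ⁻¹' (Ω : Set (Fin d → ℝ))) := fun a =>
    Ω.isOpen.preimage (dilation a.1 a.2).continuous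
  have hcover : (K : Set (Fin d → ℝ)) ⊆
      ⋃ a : RStar d, dilation a.1 a.2 ⁻¹' (Ω : Set (Fin d → ℝ)) := fun x hx => by
    obtain ⟨a, ha, w, hw, rfl⟩ := mem_dilationHull.1 (hK hx)
    refine mem_iUnion.2 ⟨⟨a⁻¹, inv_mem ha⟩, ?_⟩
    change a * w * a⁻¹ ∈ Ω
    rwa [mul_comm, inv_mul_cancel_of_mem ha]
  obtain ⟨t, ht⟩ := K.isCompact.elim_finite_subcover _ hopen hcover
  obtain ⟨χ, hχ⟩ := SmoothPartitionOfUnity.exists_isSubordinate 𝓘(ℝ, Fin d → ℝ)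
    K.isCompact.isClosed (fun a : t => dilation a.1.1 a.1.2 ⁻¹' (Ω : Set (Fin d → ℝ)))
    (fun a => hopen a) (fun x hx => by
      obtain ⟨a, ha, hxa⟩ := mem_iUnion₂.1 (ht hx)
      exact mem_iUnion.2 ⟨⟨a, ha⟩, hxa⟩)
  have hχs : ∀ a : t, ContDiff ℝ ∞ fun x => ((χ a x : ℝ) : 𝕜) := fun a =>
    (RCLike.ofRealCLM (K := 𝕜)).contDiff.comp (χ a).contMDiff.contDiff
  have hχt : ∀ a : t, tsupport (fun x => ((χ a x : ℝ) : 𝕜)) ⊆ tsupport (χ a) := fun a =>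
    closure_mono fun x hx h => hx (by simp [h])
  let K₁ : t → Compacts (Fin d → ℝ) := fun a =>
    ⟨K ∩ tsupport (χ a), K.isCompact.inter_right (isClosed_tsupport _)⟩
  let D : t → (Fin d → ℝ) → (Fin d → ℝ) := fun a => dilation a.1.1 a.1.2
  let K₂ : t → Compacts (Fin d → ℝ) := fun a => ⟨D a '' K₁ a,
    (K₁ a).isCompact.image (dilation a.1.1 a.1.2).continuous⟩
  have hK₂ : ∀ a, (K₂ a : Set (Fin d → ℝ)) ⊆ Ω := fun a => by
    rintro _ ⟨x, hx, rfl⟩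
    exact hχ a hx.2
  let g : RStar d → (Fin d → ℝ) →L[ℝ] (Fin d → ℝ) := fun a =>
    LinearMap.toContinuousLinearMap (LinearMap.mulRight ℝ a.1⁻¹)
  have hg : ∀ a : t, g a ⁻¹' K₁ a ⊆ K₂ a := fun a x hx =>
    ⟨x * a.1.1⁻¹, hx, (dilation a.1.1 a.1.2).right_inv x⟩
  -- The piece f χ_a lives where x a ∈ Ω; composing it with x ↦ x a⁻¹ moves its support into Ω.
  let P : t → 𝓓_{K}(Fin d → ℝ, 𝕜) →L[𝕜] 𝓓(Ω, 𝕜) := fun a =>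
    TestFunction.ofSupportedInCLM 𝕜 (hK₂ a) ∘L compLinearCLM 𝕜 (g a) (hg a) ∘L
      mulSmoothCLM (K' := K₁ a) (hχs a) (inter_subset_inter_right _ (hχt a))
  have hP : ∀ a f x, P a f (x * a.1.1) = f x * (χ a x : ℝ) := fun a f x => by
    change f (x * a.1.1 * a.1.1⁻¹) * (χ a (x * a.1.1 * a.1.1⁻¹) : ℝ) = _
    rw [show x * a.1.1 * a.1.1⁻¹ = x from (dilation a.1.1 a.1.2).left_inv x]
  classical
  refine ⟨t, fun a => if h : a ∈ t then P ⟨a, h⟩ else 0, fun f x => ?_⟩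
  rw [← Finset.sum_coe_sort]
  simp only [Finset.coe_mem, dite_true, Subtype.coe_eta]
  simp_rw [hP, ← Finset.mul_sum]
  by_cases hx : x ∈ K
  · have h := χ.sum_eq_one hx
    rw [finsum_eq_sum_of_fintype] at h
    rw [← RCLike.ofReal_sum, h, RCLike.ofReal_one, mul_one]
  · have : f x = 0 := f.zero_on_compl hx
    rw [this, zero_mul]

end HadamardOp

/-! ### The transpose operator and the kernel T. -/

namespace HadamardOp

open Filter Set
open scoped Topology ContDiff

variable {𝕜 : Type*} [RCLike 𝕜] {d : ℕ} {Ω : Opens (Fin d → ℝ)}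

theorem isVonNBounded_singleton_testFunction (φ : 𝓓(Ω, 𝕜)) :
    Bornology.IsVonNBounded 𝕜 {φ} := by
  let f : 𝓓_{(⟨tsupport φ, φ.hasCompactSupport⟩ : Compacts (Fin d → ℝ))}(Fin d → ℝ, 𝕜) :=
    ContDiffMapSupportedIn.of_support_subset φ.contDiff (subset_tsupport φ)
  have h := (Bornology.isVonNBounded_singleton (𝕜 := 𝕜) f).image (σ := RingHom.id 𝕜)
    (TestFunction.ofSupportedInCLM 𝕜 (n := ⊤) (F := 𝕜) (Ω := Ω) φ.tsupport_subset)
  rwa [image_singleton] at h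

/-- Evaluation of distributions at a test function. -/
noncomputable def evalTestFunction (φ : 𝓓(Ω, 𝕜)) : DPrime 𝕜 Ω →L[𝕜] 𝕜 where
  toFun S := S φ
  map_add' _ _ := rfl
  map_smul' _ _ := rfl
  cont := by
    let F : DPrime 𝕜 Ω →ₗ[𝕜] 𝕜 := ⟨⟨fun S => S φ, fun _ _ => rfl⟩, fun _ _ => rfl⟩
    refine continuous_of_continuousAt_zero F ?_
    rw [ContinuousAt, map_zero]
    intro V hV
    exact (ContinuousLinearMap.hasBasis_nhds_zero (𝕜₁ := 𝕜) (σ := RingHom.id 𝕜)).mem_iff.2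
      ⟨({φ}, V), ⟨isVonNBounded_singleton_testFunction φ, hV⟩, fun S hS => hS φ rfl⟩

/-- A continuous linear operator on distributions is the transpose of a linear operator on test
functions. -/
theorem exists_transpose (L : DPrime 𝕜 Ω →L[𝕜] DPrime 𝕜 Ω) :
    ∃ M : 𝓓(Ω, 𝕜) →ₗ[𝕜] 𝓓(Ω, 𝕜), ∀ S φ, L S φ = S (M φ) := by
  choose M hM using fun φ : 𝓓(Ω, 𝕜) => exists_forall_eq_apply (evalTestFunction φ ∘L L)
  have hM' : ∀ φ S, L S φ = S (M φ) := fun φ S => hM φ S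
  refine ⟨⟨⟨M, fun φ ψ => ?_⟩, fun c φ => ?_⟩, fun S φ => hM' φ S⟩
  · ext x
    rw [← dirac_apply x, ← hM', map_add, hM', hM', ← map_add, dirac_apply]
  · ext x
    rw [← dirac_apply x, ← hM', map_smul, hM', ← map_smul, dirac_apply, RingHom.id_apply]

/-- Diagonal scaling: the seminorms p i increase with i, so dividing φ n by 1 + p n (φ n) bounds p i
by 1 for all n ≥ i, and finitely many n remain. -/
theorem exists_smul_isVonNBounded_range {K : Compacts (Fin d → ℝ)}
    (φ : ℕ → 𝓓_{K}(Fin d → ℝ, 𝕜)) :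
    ∃ c : ℕ → 𝕜, (∀ n, c n ≠ 0) ∧ Bornology.IsVonNBounded 𝕜 (range fun n => c n • φ n) := by
  let p := ContDiffMapSupportedIn.supSeminorm 𝕜 (Fin d → ℝ) 𝕜 ⊤ K
  have hpos : ∀ n, 0 < 1 + p n (φ n) := fun n => by
    have := apply_nonneg (p n) (φ n)
    linarith
  let c : ℕ → 𝕜 := fun n => ((1 + p n (φ n) : ℝ) : 𝕜)⁻¹
  have hmono : ∀ i n, i ≤ n → p i (c n • φ n) ≤ 1 := fun i n hin => by
    have h1 : p i ≤ p n := Finset.sup_mono (Finset.Iic_subset_Iic.2 hin)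
    refine (h1 _).trans ?_
    rw [map_smul_eq_mul, norm_inv, RCLike.norm_ofReal, abs_of_pos (hpos n),
      inv_mul_le_one₀ (hpos n)]
    linarith
  refine ⟨c, fun n => inv_ne_zero (RCLike.ofReal_ne_zero.2 (hpos n).ne'), ?_⟩
  rw [(ContDiffMapSupportedIn.withSeminorms' 𝕜 (Fin d → ℝ) 𝕜 ⊤
    K).isVonNBounded_iff_seminorm_bounded]
  intro i
  have hsum : 0 ≤ ∑ n ∈ Finset.range i, p i (c n • φ n) :=
    Finset.sum_nonneg fun n _ => apply_nonneg _ _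
  refine ⟨2 + ∑ n ∈ Finset.range i, p i (c n • φ n), by linarith, ?_⟩
  rintro _ ⟨n, rfl⟩
  change p i (c n • φ n) < _
  rcases lt_or_ge n i with h | h
  · have := Finset.single_le_sum (f := fun n => p i (c n • φ n))
      (fun n _ => apply_nonneg _ _) (Finset.mem_range.2 h)
    linarith
  · linarith [hmono i n h]

/-- A sequence of counterexamples can be rescaled to be bounded without changing supports. Its image
under M is weakly bounded because S (M φ) = L S φ and L S is continuous, hence has a common compact
support. Continuity of M is not needed. -/
theorem exists_compact_tsupport_transpose_subset {L : DPrime 𝕜 Ω →L[𝕜] DPrime 𝕜 Ω}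
    {M : 𝓓(Ω, 𝕜) →ₗ[𝕜] 𝓓(Ω, 𝕜)} (hM : ∀ S φ, L S φ = S (M φ)) (K : Compacts (Fin d → ℝ))
    (hK : (K : Set (Fin d → ℝ)) ⊆ Ω) :
    ∃ K' : Compacts (Fin d → ℝ), (K' : Set (Fin d → ℝ)) ⊆ Ω ∧
      ∀ φ : 𝓓(Ω, 𝕜), tsupport φ ⊆ K → tsupport (M φ) ⊆ K' := by
  by_contra! H
  obtain ⟨Q, -, hQΩ, hQ⟩ := exists_compact_exhaustion Ω
  choose φ hφK hφ using fun n => H (Q n) (hQΩ n)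
  let f : ℕ → 𝓓_{K}(Fin d → ℝ, 𝕜) := fun n =>
    ContDiffMapSupportedIn.of_support_subset (φ n).contDiff
      ((subset_tsupport (φ n)).trans (hφK n))
  obtain ⟨c, hc, hbdd⟩ := exists_smul_isVonNBounded_range f
  obtain ⟨K', hK'Ω, hK'⟩ := exists_compact_forall_tsupport_subset
    (B := range fun n => M (c n • φ n)) fun S => by
      obtain ⟨C, hC⟩ := ((NormedSpace.isVonNBounded_iff 𝕜).1 (hbdd.image (σ := RingHom.id 𝕜)
        (L S ∘L TestFunction.ofSupportedInCLM 𝕜 hK))).exists_norm_le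
      refine ⟨C, ?_⟩
      rintro _ ⟨n, rfl⟩
      rw [← hM]
      exact hC _ ⟨_, ⟨n, rfl⟩, rfl⟩
  obtain ⟨n, hn⟩ := hQ K' K'.isCompact hK'Ω
  refine hφ n (Subset.trans ?_ ((hK' _ ⟨n, rfl⟩).trans hn))
  refine closure_mono fun x hx => ?_
  change M (c n • φ n) x ≠ 0
  rw [map_smul]
  exact mul_ne_zero (hc n) hx

theorem hasMoments_transpose {L : DPrime 𝕜 Ω →L[𝕜] DPrime 𝕜 Ω}
    {M : 𝓓(Ω, 𝕜) →ₗ[𝕜] 𝓓(Ω, 𝕜)} (hM : ∀ S φ, L S φ = S (M φ)) {m : (Fin d → ℕ) → 𝕜}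
    (hm : ∀ α, L (monomial 𝕜 Ω α) = m α • monomial 𝕜 Ω α) (φ : 𝓓(Ω, 𝕜)) :
    HasMoments m φ (M φ) := fun α => by
  rw [← monomial_apply, ← monomial_apply, ← hM, hm]
  rfl

theorem hasMoments_sum_dilate {M : 𝓓(Ω, 𝕜) →ₗ[𝕜] 𝓓(Ω, 𝕜)} {m : (Fin d → ℕ) → 𝕜}
    (hm : ∀ φ : 𝓓(Ω, 𝕜), HasMoments m φ (M φ)) {t : Finset (RStar d)} {φ : RStar d → 𝓓(Ω, 𝕜)}
    {f : (Fin d → ℝ) → 𝕜} (hf : ∀ x, f x = ∑ a ∈ t, φ a (x * a.1)) :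
    HasMoments m f (∑ a ∈ t, dilate (incl (M (φ a))) a.1 a.2 : 𝓓(dilationHull Ω, 𝕜)) := by
  have h1 : f = fun x => ∑ a ∈ t, dilate (incl (φ a)) a.1 a.2 x := funext hf
  have h2 : ((∑ a ∈ t, dilate (incl (M (φ a))) a.1 a.2 : 𝓓(dilationHull Ω, 𝕜)) :
      (Fin d → ℝ) → 𝕜) = fun x => ∑ a ∈ t, dilate (incl (M (φ a))) a.1 a.2 x := funext fun x =>
    map_sum (dirac 𝕜 (dilationHull Ω) x) _ _
  rw [h1, h2]
  exact HasMoments.sum t (fun a _ => (hm (φ a)).comp_mul_right a.2)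
    (fun a _ => TestFunction.continuous _) (fun a _ => TestFunction.hasCompactSupport _)
    (fun a _ => TestFunction.continuous _) (fun a _ => TestFunction.hasCompactSupport _)

theorem HasMoments.testFunction_unique {Ω₁ Ω₂ : Opens (Fin d → ℝ)} {m : (Fin d → ℕ) → 𝕜}
    {φ : (Fin d → ℝ) → 𝕜} {ψ₁ : 𝓓(Ω₁, 𝕜)} {ψ₂ : 𝓓(Ω₂, 𝕜)} (h₁ : HasMoments m φ ψ₁)
    (h₂ : HasMoments m φ ψ₂) (x : Fin d → ℝ) : ψ₁ x = ψ₂ x :=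
  congrFun (h₁.unique h₂ ψ₁.continuous ψ₂.continuous ψ₁.hasCompactSupport ψ₂.hasCompactSupport) x

/-- The distribution representing a Hadamard operator, with the extension to `𝓓(Ω̃)` of the
transpose of the operator. -/
theorem exists_kernel {L : DPrime 𝕜 Ω →L[𝕜] DPrime 𝕜 Ω} {M : 𝓓(Ω, 𝕜) →ₗ[𝕜] 𝓓(Ω, 𝕜)}
    (hM : ∀ S φ, L S φ = S (M φ)) {m : (Fin d → ℕ) → 𝕜}
    (hm : ∀ φ : 𝓓(Ω, 𝕜), HasMoments m φ (M φ)) :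
    ∃ (T : DPrime 𝕜 (dilationHull Ω)) (N : 𝓓(dilationHull Ω, 𝕜) → 𝓓(dilationHull Ω, 𝕜)),
      (∀ φ, IsTransform T φ (N φ)) ∧ ∀ (φ : 𝓓(Ω, 𝕜)) x, N (incl φ) x = M φ x := by
  have hex : ∀ φ : 𝓓(dilationHull Ω, 𝕜), ∃ ψ : 𝓓(dilationHull Ω, 𝕜), HasMoments m φ ψ := by
    intro φ
    obtain ⟨t, P, hP⟩ := exists_decomposition (𝕜 := 𝕜)
      ⟨tsupport φ, φ.hasCompactSupport⟩ φ.tsupport_subset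
    exact ⟨_, hasMoments_sum_dilate hm
      (hP (ContDiffMapSupportedIn.of_support_subset φ.contDiff (subset_tsupport φ)))⟩
  choose N hN using hex
  choose t P hP using fun (K : Compacts (Fin d → ℝ)) (hK : (K : Set (Fin d → ℝ)) ⊆
    dilationHull Ω) => exists_decomposition (𝕜 := 𝕜) K hK
  -- By uniqueness N f may be computed from any decomposition, so on functions supported in K one
  -- has N f 1 = ∑ M (P_a f)(a) = ∑ L(δ_a)(P_a f), which is continuous in f. For a ∉ Ω, δ_a is zero
  -- on 𝓓(Ω).
  let T : DPrime 𝕜 (dilationHull Ω) := TestFunction.limitCLM 𝕜 (fun φ => N φ 1)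
    (fun K hK => ∑ a ∈ t K hK, L (dirac 𝕜 Ω a.1) ∘L P K hK a) (fun K hK f => by
      rw [(hN _).testFunction_unique (hasMoments_sum_dilate hm (hP K hK f)) 1,
        ← dirac_apply (𝕜 := 𝕜), map_sum, sum_apply]
      refine Finset.sum_congr rfl fun a _ => ?_
      rw [ContinuousLinearMap.comp_apply, hM]
      change M (P K hK a f) (1 * a.1) = M (P K hK a f) a.1
      rw [one_mul])
  refine ⟨T, N, fun φ y hy => ?_, fun φ x => (hN (incl φ)).testFunction_unique (hm φ) x⟩
  -- N commutes with dilations, as both sides have the same moments.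
  have h := (hN (dilate φ y hy)).testFunction_unique (ψ₂ := dilate (N φ) y hy)
    ((hN φ).comp_mul_right hy) 1
  change _ = N (dilate φ y hy) 1
  rw [h]
  change _ = N φ (1 * y)
  rw [one_mul]

/-! ### The support of the kernel. -/

/-- A test function u supported in this set is φ(· y) with φ = u(· y⁻¹) supported in K, so T u = (M
φ)(y) = 0. -/
theorem isVanishingOn_kernel {M : 𝓓(Ω, 𝕜) → 𝓓(Ω, 𝕜)} {T : DPrime 𝕜 (dilationHull Ω)}
    (hT : ∀ φ : 𝓓(Ω, 𝕜), IsTransform T (incl φ) (M φ)) {K K' : Set (Fin d → ℝ)} (hKΩ : K ⊆ Ω)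
    (hKK' : ∀ φ : 𝓓(Ω, 𝕜), tsupport φ ⊆ K → tsupport (M φ) ⊆ K') {y : Fin d → ℝ}
    (hy : y ∈ RStar d) (hyK' : y ∉ K') :
    Distribution.IsVanishingOn T {x | x * y ∈ interior K} := by
  intro u hu
  have hsub : tsupport (fun x => u (x * y⁻¹)) ⊆ K := by
    intro x hx
    have hx' : x * y⁻¹ ∈ tsupport u :=
      tsupport_comp_subset_preimage u (dilation y⁻¹ (inv_mem hy)).continuous hx
    have h := hu hx'
    rw [mem_ofPred_eq, mul_assoc, mul_comm, mul_assoc, inv_mul_cancel_of_mem hy] at h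
    exact interior_subset h
  let φ : 𝓓(Ω, 𝕜) := ⟨fun x => u (x * y⁻¹), (dilate u y⁻¹ (inv_mem hy)).contDiff,
    (dilate u y⁻¹ (inv_mem hy)).hasCompactSupport, hsub.trans hKΩ⟩
  have hφ : dilate (incl φ) y hy = u := by
    ext x
    exact congrArg u ((dilation y hy).left_inv x)
  rw [← hφ, ← hT φ y hy]
  exact image_eq_zero_of_notMem_tsupport fun h => hyK' (hKK' φ hsub h)

theorem dense_rStar (d : ℕ) : Dense (RStar d) := by
  have h := dense_pi (univ : Set (Fin d)) (s := fun _ => ({0}ᶜ : Set ℝ))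
    fun _ _ => dense_compl_singleton 0
  convert h using 1
  ext x
  simp [RStar, Set.mem_pi]

theorem supp_subset_rStar {T : DPrime 𝕜 (dilationHull Ω)}
    (h : ∀ K : Compacts (Fin d → ℝ), (K : Set (Fin d → ℝ)) ⊆ Ω →
      ∃ K' : Compacts (Fin d → ℝ), (K' : Set (Fin d → ℝ)) ⊆ Ω ∧
        ∀ y ∈ RStar d, y ∉ K' → Distribution.IsVanishingOn T {x | x * y ∈ interior K}) :
    supp T ⊆ RStar d := by
  rintro x ⟨hxT, hxΩ⟩ j hj
  obtain ⟨a, ha, w, hw, rfl⟩ := mem_dilationHull.1 hxΩ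
  obtain ⟨K, hK, hwK, hKΩ⟩ := exists_compact_subset Ω.isOpen hw
  obtain ⟨K', -, hK'⟩ := h ⟨K, hK⟩ hKΩ
  obtain ⟨R, hR⟩ := K'.isCompact.isBounded.exists_norm_le
  have hwj : w j = 0 := (mul_eq_zero.1 hj).resolve_left (ha j)
  -- As the j-th coordinate of x = a w is 0, y_j does not affect x y = w and can be taken so large
  -- that y ∉ K'.
  let y : Fin d → ℝ := Function.update a⁻¹ j (|R| + 1)
  have hR1 : 0 < |R| + 1 := by positivity
  have hy : y ∈ RStar d := fun i => by
    by_cases hi : i = j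
    · subst hi; simpa [y] using hR1.ne'
    · simpa [y, hi] using ha i
  have hyK' : y ∉ K' := fun hyK' => by
    have h1 := (norm_le_pi_norm y j).trans (hR y hyK')
    have h2 : y j = |R| + 1 := by simp [y]
    rw [h2, Real.norm_of_nonneg hR1.le] at h1
    linarith [le_abs_self R]
  have hmem : a * w * y = w := by
    ext i
    by_cases hi : i = j
    · subst hi; simp [hwj]
    · have := ha i
      simp [y, hi]
      field_simp
  exact ((hK' y hy hyK').disjoint_dsupport (isOpen_interior.preimage (by fun_prop))).le_bot
    ⟨by change a * w * y ∈ interior K; rwa [hmem], hxT⟩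

/-- If s⁻¹ ∈ supp T and s k ∉ K', then y = s k would put s⁻¹ in a set where T vanishes. Since y must
lie in ℝ_*^d, k is first perturbed to a nearby z ∈ ℝ_*^d. -/
theorem inv_supp_mul_subset {T : DPrime 𝕜 (dilationHull Ω)} (hT : supp T ⊆ RStar d)
    {C K K' : Set (Fin d → ℝ)} (hCK : C ⊆ interior K) (hK' : IsClosed K')
    (h : ∀ y ∈ RStar d, y ∉ K' → Distribution.IsVanishingOn T {x | x * y ∈ interior K}) :
    (supp T)⁻¹ * C ⊆ K' := by
  rintro _ ⟨s, hs, k, hk, rfl⟩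
  have hs' : s⁻¹ ∈ RStar d := hT hs
  by_contra hsk
  have hopen : IsOpen (interior K ∩ {z | s * z ∉ K'}) :=
    isOpen_interior.inter (hK'.isOpen_compl.preimage (by fun_prop))
  obtain ⟨z, ⟨hzK, hz⟩, hzR⟩ := (dense_rStar d).inter_open_nonempty _ hopen ⟨k, hCK hk, hsk⟩
  have hsR : s ∈ RStar d := by simpa using inv_mem hs'
  refine ((h (s * z) (mul_mem hsR hzR) hz).disjoint_dsupport
    (isOpen_interior.preimage (by fun_prop))).le_bot ⟨?_, hs.1⟩
  change s⁻¹ * (s * z) ∈ interior K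
  rwa [inv_mul_cancel_of_mem hsR]

end HadamardOp

theorem theorem3p8 {𝕜 : Type*} [RCLike 𝕜] {d : ℕ} (Ω : Opens (Fin d → ℝ))
    (L : HadamardOp.DPrime 𝕜 Ω →L[𝕜] HadamardOp.DPrime 𝕜 Ω) (hL : HadamardOp.IsHadamard L) :
    ∃ T : HadamardOp.DPrime 𝕜 (HadamardOp.dilationHull Ω),
      HadamardOp.MemDH T ∧
        ∀ S : HadamardOp.DPrime 𝕜 Ω, HadamardOp.IsMulConvolution S T (L S) := by
  open HadamardOp in
  obtain ⟨M, hM⟩ := exists_transpose L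
  choose m hm using hL
  obtain ⟨T, N, hTN, hNM⟩ := exists_kernel hM (hasMoments_transpose hM hm)
  have hTM : ∀ φ : 𝓓(Ω, 𝕜), IsTransform T (incl φ) (M φ) := fun φ y hy => by
    rw [← hNM]
    exact hTN _ y hy
  have hvan : ∀ K : Compacts (Fin d → ℝ), (K : Set (Fin d → ℝ)) ⊆ Ω →
      ∃ K' : Compacts (Fin d → ℝ), (K' : Set (Fin d → ℝ)) ⊆ Ω ∧
        ∀ y ∈ RStar d, y ∉ K' →
          Distribution.IsVanishingOn T {x | x * y ∈ interior (K : Set (Fin d → ℝ))} := by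
    intro K hK
    obtain ⟨K', hK'Ω, hK'⟩ := exists_compact_tsupport_transpose_subset hM K hK
    exact ⟨K', hK'Ω, fun y hy hyK' => isVanishingOn_kernel hTM hK hK' hy hyK'⟩
  have hsupp := supp_subset_rStar hvan
  refine ⟨T, ⟨fun φ => ⟨N φ, hTN φ⟩, hsupp, fun C hC hCΩ => ?_⟩, fun S φ => ⟨M φ, hTM φ, hM S φ⟩⟩
  -- C is enlarged because T is known to vanish only where x y lies in the interior of K.
  obtain ⟨K, hK, hCK, hKΩ⟩ := exists_compact_between hC Ω.isOpen hCΩ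
  obtain ⟨K', hK'Ω, hK'⟩ := hvan ⟨K, hK⟩ hKΩ
  exact ⟨K', K'.isCompact, hK'Ω, inv_supp_mul_subset hsupp hCK K'.isCompact.isClosed hK'⟩
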